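/- Let $n,m_1,m_2\ge 1$ and let $(X_i,Y_i)$, $i=1,\dots,n$, be independent pairs, where $Y_i$ is an integrable real random variable, $X_i$ is uniformly distributed on the set $\{e_je_k^T:1\le j\le m_1,\ 1\le k\le m_2\}\subset\mathbb{R}^{m_1\times m_2}$ (matrix completion under uniform sampling at random) and $E(Y_i\mid X_i)=\mathrm{tr}(X_i^TA_0)$ almost surely for a fixed matrix $A_0\in\mathbb{R}^{m_1\times m_2}$. Let $\sigma_1(A)\ge\sigma_2(A)\ge\dots$ be the singular values of a matrix $A$, and let $\|A\|_q=\big(\sum_{j=1}^{\min(m_1,m_2)}\sigma_j(A)^q\big)^{1/q}$ for $0<q<\infty$ and $\|A\|_\infty=\sigma_1(A)$. Put $\langle A,B\rangle=\mathrm{tr}(A^TB)$, $\|A\|_{L_2(\Pi)}^2=\frac1n\sum_{i=1}^nE\big(\langle A,X_i\rangle^2\big)$, $M=\frac1n\sum_{i=1}^n\big(Y_iX_i-E(Y_iX_i)\big)$ and $\Delta=\|M\|_\infty$. Let $\lambda>0$ and let $$\hat A\in\operatorname*{argmin}_{A\in\mathbb{R}^{m_1\times m_2}}\Big\{\|A\|_{L_2(\Pi)}^2-\Big\langle\frac2n\sum_{i=1}^nY_iX_i,A\Big\rangle+\lambda\,\mathrm{rank}(A)\Big\}.$$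 Then the following holds at every sample point. If $\mathbf X=\frac{m_1m_2}{n}\sum_{i=1}^nY_iX_i=\sum_{j=1}^{\mathrm{rank}\,\mathbf X}\sigma_j(\mathbf X)u_jv_j^T$ is any singular value decomposition, then the hard thresholding $\sum_{j:\,\sigma_j(\mathbf X)\ge\sqrt{\lambda m_1m_2}}\sigma_j(\mathbf X)u_jv_j^T$ is such a minimizer $\hat A$. Moreover, let $\mu>0$ be a constant with $\|A\|_{L_2(\Pi)}^2\ge\mu^{-2}\|A\|_2^2$ for all $A\in\mathbb{R}^{m_1\times m_2}$ (for example $\mu=\sqrt{m_1m_2}$, for which equality holds). If $\sqrt\lambda\ge 2\mu\Delta$, then every such minimizer $\hat A$, with $\hat r=\mathrm{rank}(\hat A)$, satisfies (i) $\hat r\le\mathrm{rank}(A_0)$; (ii) $|\sigma_j(\hat A)-\sigma_j(A_0)|\le\frac{\sqrt{\lambda m_1m_2}}{2}$ for $j=1,\dots,\hat r$; (iii) $\|\hat A-A_0\|_\infty\le\frac32\sqrt{\lambda m_1m_2}$; (iv) for $2\le q\le\infty$, $\|\hat A-A_0\|_q\le\frac32\left(\frac43\right)^{2/q}\sqrt{m_1m_2\lambda}\,(\mathrm{rank}(A_0))^{1/q}$,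 where $x^{1/q}=1$ for $x>0$, $q=\infty$, and $0^{1/q}=0$ for all $q$. -/

import Mathlib

open MeasureTheory ProbabilityTheory
open scoped ENNReal Matrix

noncomputable section

namespace TraceRegression

/-- The product (Borel) σ-algebra on real matrices. -/
instance instMeasurableSpaceMatrix (m₁ m₂ : ℕ) : MeasurableSpace (Matrix (Fin m₁) (Fin m₂) ℝ) :=
  inferInstanceAs (MeasurableSpace (Fin m₁ → Fin m₂ → ℝ))

/-- The singular values of a real matrix in decreasing order, indexed from `0`
(so `singularValue A 0` is the largest one), extended by zeros. -/
def singularValue {m₁ m₂ : ℕ} (A : Matrix (Fin m₁) (Fin m₂) ℝ) (j : ℕ) : ℝ :=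
  (Matrix.toEuclideanLin A).singularValues j

/-- The Schatten-`q` (quasi-)norm, for `0 < q ≤ ∞`. -/
def schattenNorm {m₁ m₂ : ℕ} (q : ℝ≥0∞) (A : Matrix (Fin m₁) (Fin m₂) ℝ) : ℝ :=
  if q = ⊤ then singularValue A 0
  else (∑ j ∈ Finset.range (min m₁ m₂), singularValue A j ^ q.toReal) ^ (1 / q.toReal)

/-- The power `x ^ (1 / q)` for `x ≥ 0` and `0 < q ≤ ∞`, with `0 ^ (1 / q) = 0` for every `q`
and `x ^ (1 / ∞) = 1` for `x > 0`. -/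
def qRoot (q : ℝ≥0∞) (x : ℝ) : ℝ :=
  if x = 0 then 0 else x ^ (1 / q).toReal

/-- The scalar product `⟨A, B⟩ = tr(Aᵀ B)`. -/
def matInner {m₁ m₂ : ℕ} (A B : Matrix (Fin m₁) (Fin m₂) ℝ) : ℝ :=
  (Aᵀ * B).trace

/-- The set of matrices `e_j e_kᵀ`, with exactly one nonzero entry, equal to `1`. -/
def entryBasis (m₁ m₂ : ℕ) : Set (Matrix (Fin m₁) (Fin m₂) ℝ) :=
  Set.range fun p : Fin m₁ × Fin m₂ => Matrix.single p.1 p.2 (1 : ℝ)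

section Model

variable {Ω : Type*} [MeasurableSpace Ω] {n m₁ m₂ : ℕ}

/-- The trace regression model: independent pairs `(X i, Y i)` with
`E(Y i | X i) = tr((X i)ᵀ A₀)` almost surely. -/
structure IsTraceRegression (P : Measure Ω) (X : Fin n → Ω → Matrix (Fin m₁) (Fin m₂) ℝ)
    (Y : Fin n → Ω → ℝ) (A₀ : Matrix (Fin m₁) (Fin m₂) ℝ) : Prop where
  measurable_X : ∀ i, Measurable (X i)
  measurable_Y : ∀ i, Measurable (Y i)
  integrable_Y : ∀ i, Integrable (Y i) P
  indep : iIndepFun (fun i ω => (X i ω, Y i ω)) P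
  condExp_Y : ∀ i, P[Y i | MeasurableSpace.comap (X i) inferInstance]
    =ᵐ[P] fun ω => ((X i ω)ᵀ * A₀).trace

/-- Uniform sampling at random: every design matrix is uniformly distributed on the set of
matrices `e_j e_kᵀ`. -/
def IsUSR (P : Measure Ω) (X : Fin n → Ω → Matrix (Fin m₁) (Fin m₂) ℝ) : Prop :=
  ∀ i, P.map (X i) = uniformOn (entryBasis m₁ m₂)

/-- The symmetric bilinear form `⟨A, B⟩_{L₂(Π)} = (1/n) ∑ E(⟨A, X i⟩ ⟨B, X i⟩)`. -/
def innerPi (P : Measure Ω) (X : Fin n → Ω → Matrix (Fin m₁) (Fin m₂) ℝ)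
    (A B : Matrix (Fin m₁) (Fin m₂) ℝ) : ℝ :=
  (1 / (n : ℝ)) * ∑ i, ∫ ω, matInner A (X i ω) * matInner B (X i ω) ∂P

/-- The squared norm `‖A‖²_{L₂(Π)}`. -/
def sqNormPi (P : Measure Ω) (X : Fin n → Ω → Matrix (Fin m₁) (Fin m₂) ℝ)
    (A : Matrix (Fin m₁) (Fin m₂) ℝ) : ℝ :=
  innerPi P X A A

/-- The constant `μ > 0` is such that `‖A‖²_{L₂(Π)} ≥ μ⁻² ‖A‖₂²` for all matrices `A`. -/
def LowerIsometry (P : Measure Ω) (X : Fin n → Ω → Matrix (Fin m₁) (Fin m₂) ℝ) (μ : ℝ) : Prop :=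
  0 < μ ∧ ∀ A : Matrix (Fin m₁) (Fin m₂) ℝ,
    (μ ^ 2)⁻¹ * schattenNorm 2 A ^ 2 ≤ sqNormPi P X A

/-- The criterion `ψ(A) = ‖A‖²_{L₂(Π)} - ⟨(2/n) ∑ Y i X i, A⟩ + lam rank(A)`, at the
observations made at the sample point `ω`. -/
def criterion (P : Measure Ω) (X : Fin n → Ω → Matrix (Fin m₁) (Fin m₂) ℝ) (Y : Fin n → Ω → ℝ)
    (lam : ℝ) (ω : Ω) (A : Matrix (Fin m₁) (Fin m₂) ℝ) : ℝ :=
  sqNormPi P X A - matInner ((2 / (n : ℝ)) • ∑ i, Y i ω • X i ω) A + lam * (A.rank : ℝ)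

/-- `Ahat` is (a value at `ω` of) the rank penalized estimator: it minimizes the criterion over
all matrices. -/
def IsRankPenalizedEstimator (P : Measure Ω) (X : Fin n → Ω → Matrix (Fin m₁) (Fin m₂) ℝ)
    (Y : Fin n → Ω → ℝ) (lam : ℝ) (ω : Ω) (Ahat : Matrix (Fin m₁) (Fin m₂) ℝ) : Prop :=
  ∀ A : Matrix (Fin m₁) (Fin m₂) ℝ, criterion P X Y lam ω Ahat ≤ criterion P X Y lam ω A

/-- The matrix `(m₁ m₂ / n) ∑ Y i X i` constructed from the observations. -/
def dataMatrix (X : Fin n → Ω → Matrix (Fin m₁) (Fin m₂) ℝ) (Y : Fin n → Ω → ℝ) (ω : Ω) :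
    Matrix (Fin m₁) (Fin m₂) ℝ :=
  ((m₁ : ℝ) * (m₂ : ℝ) / (n : ℝ)) • ∑ i, Y i ω • X i ω

/-- The random matrix `M = (1/n) ∑ (Y i X i - E(Y i X i))`, with entrywise expectation. -/
def noiseMatrix (P : Measure Ω) (X : Fin n → Ω → Matrix (Fin m₁) (Fin m₂) ℝ) (Y : Fin n → Ω → ℝ)
    (ω : Ω) : Matrix (Fin m₁) (Fin m₂) ℝ :=
  (1 / (n : ℝ)) • ∑ i, (Y i ω • X i ω - Matrix.of fun j k => ∫ ω', Y i ω' * X i ω' j k ∂P)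

/-- The noise level `Δ = ‖M‖_∞`. -/
def noiseLevel (P : Measure Ω) (X : Fin n → Ω → Matrix (Fin m₁) (Fin m₂) ℝ) (Y : Fin n → Ω → ℝ)
    (ω : Ω) : ℝ :=
  schattenNorm ⊤ (noiseMatrix P X Y ω)

end Model

/-- `B` is obtained from `Z` by hard thresholding of its singular values at level `t`: for a
singular value decomposition `Z = ∑ σ_j u_j v_jᵀ`, `B` is the sum of the terms with `σ_j ≥ t`. -/
def IsHardThresholding {m₁ m₂ : ℕ} (Z : Matrix (Fin m₁) (Fin m₂) ℝ) (t : ℝ)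
    (B : Matrix (Fin m₁) (Fin m₂) ℝ) : Prop :=
  ∃ (u : Fin Z.rank → EuclideanSpace ℝ (Fin m₁)) (v : Fin Z.rank → EuclideanSpace ℝ (Fin m₂)),
    Orthonormal ℝ u ∧ Orthonormal ℝ v ∧
    Z = ∑ j : Fin Z.rank, singularValue Z j • Matrix.vecMulVec (u j).ofLp (v j).ofLp ∧
    B = ∑ j : Fin Z.rank, if t ≤ singularValue Z j then
      singularValue Z j • Matrix.vecMulVec (u j).ofLp (v j).ofLp else 0

end TraceRegression

end

/-! Under uniform sampling `E⟨A, X⟩² = ‖A‖₂² / (m₁m₂)`. Completing the square makes the criterion,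
up to a positive factor and a constant, `‖Z - A‖₂² + t² rank A`, with `Z` the data matrix and `t =
√(lam m₁m₂)`. The noise matrix is `(Z - A₀) / (m₁m₂)` and any admissible `μ` is at least `√(m₁m₂)`,
so the assumption on `lam` gives `‖Z - A₀‖_∞ ≤ t/2`. The rest is deterministic.

By Weyl's inequality the penalized distance is at least `∑ min(σ_j(Z)², t²)`, and hard thresholding
attains this. An arbitrary minimizer `B` is studied by comparison with rank-preserving and rank-one
perturbations of itself. With `W = Z - B`, these give `BᵀW = 0`, `WBᵀ = 0`, `‖W‖_∞ ≤ t`, and `σ_j(B)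
≥ t` for `j < rank B`; hence `σ_j(B) = σ_j(Z)` for these `j`. Weyl's inequality then yields (i) and
(ii), and the triangle inequality (iii). For (iv), comparing `B` with `A₀` bounds the Frobenius
error, which is interpolated with (iii). -/

namespace LinearMap

/-! ### Min-max principle, Weyl's inequality and trace duality. -/

section SingularValues

variable {E F G : Type*} [NormedAddCommGroup E] [InnerProductSpace ℝ E] [FiniteDimensional ℝ E]
  [NormedAddCommGroup F] [InnerProductSpace ℝ F] [FiniteDimensional ℝ F]

open Module

/-- The orthonormal basis of right singular vectors. -/
noncomputable def rightSingularBasis (T : E →ₗ[ℝ] F) : OrthonormalBasis (Fin (finrank ℝ E)) ℝ E :=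
  T.isSymmetric_adjoint_comp_self.eigenvectorBasis rfl

theorem norm_sq_apply_eq_sum_singularValues (T : E →ₗ[ℝ] F) (x : E) :
    ‖T x‖ ^ 2 =
      ∑ i : Fin (finrank ℝ E), T.singularValues i ^ 2 * (T.rightSingularBasis.repr x i) ^ 2 := by
  have h : ‖T x‖ ^ 2 = inner ℝ x ((adjoint T ∘ₗ T) x) := by
    rw [comp_apply, adjoint_inner_right, real_inner_self_eq_norm_sq]
  rw [h, ← T.rightSingularBasis.repr.inner_map_map, PiLp.inner_apply]
  refine Finset.sum_congr rfl fun i _ => ?_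
  have := T.isSymmetric_adjoint_comp_self.eigenvectorBasis_apply_self_apply rfl x i
  rw [rightSingularBasis, this, T.sq_singularValues_fin rfl]
  simp
  ring

theorem norm_sq_eq_sum_repr_rightSingularBasis (T : E →ₗ[ℝ] F) (x : E) :
    ‖x‖ ^ 2 = ∑ i, (T.rightSingularBasis.repr x i) ^ 2 := by
  rw [← T.rightSingularBasis.repr.norm_map, EuclideanSpace.real_norm_sq_eq]

/-- Upper half of the Courant–Fischer characterization. -/
theorem singularValues_le_of_forall_ker [AddCommGroup G] [Module ℝ G] [FiniteDimensional ℝ G]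
    (T : E →ₗ[ℝ] F) {j : ℕ} {c : ℝ} (hc : 0 ≤ c) (φ : E →ₗ[ℝ] G) (hG : finrank ℝ G ≤ j)
    (h : ∀ x, φ x = 0 → ‖T x‖ ≤ c * ‖x‖) : T.singularValues j ≤ c := by
  by_cases hj : finrank ℝ E ≤ j
  · rw [T.singularValues_of_finrank_le hj]; exact hc
  push Not at hj
  let ι : EuclideanSpace ℝ (Fin (j + 1)) →ₗ[ℝ] E :=
    { toFun := fun y => ∑ i, y i • T.rightSingularBasis (Fin.castLE hj i)
      map_add' := fun a b => by simp [add_smul, Finset.sum_add_distrib]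
      map_smul' := fun a b => by simp [mul_smul, Finset.smul_sum] }
  -- The span of the first `j + 1` right singular vectors meets `ker φ` by dimension count, and on
  -- that span `‖T x‖ ≥ σ_j ‖x‖`.
  have hker : ker (φ ∘ₗ ι) ≠ ⊥ := ker_ne_bot_of_finrank_lt (by simp; omega)
  obtain ⟨y, hy, hy0⟩ := Submodule.exists_mem_ne_zero_of_ne_bot hker
  have hrepr : ∀ i, T.rightSingularBasis.repr (ι y) i
      = if hi : (i : ℕ) < j + 1 then y ⟨i, hi⟩ else 0 := by
    intro i
    have : T.rightSingularBasis.repr (ι y) i = ∑ k, y k * if Fin.castLE hj k = i then 1 else 0 := by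
      simp only [ι, coe_mk, AddHom.coe_mk, map_sum, map_smul, OrthonormalBasis.repr_self]
      simp [Finset.sum_apply, Pi.single_apply, eq_comm]
    rw [this]
    split_ifs with hi
    · rw [Finset.sum_eq_single ⟨i, hi⟩]
      · simp
      · intro b _ hb
        rw [if_neg, mul_zero]
        rintro rfl
        exact hb rfl
      · simp
    · refine Finset.sum_eq_zero fun k _ => ?_
      rw [if_neg, mul_zero]
      rintro rfl
      exact hi k.2
  have hx0 : ι y ≠ 0 := by
    intro h0
    apply hy0
    ext k
    have := hrepr (Fin.castLE hj k)
    rw [h0] at this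
    simpa [Nat.lt_succ_of_le (Nat.le_of_lt_succ k.2)] using this.symm
  have hlow : T.singularValues j ^ 2 * ‖ι y‖ ^ 2 ≤ ‖T (ι y)‖ ^ 2 := by
    rw [T.norm_sq_apply_eq_sum_singularValues, T.norm_sq_eq_sum_repr_rightSingularBasis,
      Finset.mul_sum]
    refine Finset.sum_le_sum fun i _ => ?_
    by_cases hi : (i : ℕ) < j + 1
    · have h1 : T.singularValues j ≤ T.singularValues i :=
        T.singularValues_antitone (by omega)
      have h0 := T.singularValues_nonneg j
      gcongr
    · rw [hrepr, dif_neg hi]; simp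
  have hup := h (ι y) hy
  have hpos : 0 < ‖ι y‖ := norm_pos_iff.2 hx0
  have : T.singularValues j * ‖ι y‖ ≤ c * ‖ι y‖ := by
    refine le_trans ?_ hup
    apply le_of_sq_le_sq _ (norm_nonneg _)
    rw [mul_pow]; exact hlow
  exact le_of_mul_le_mul_right this hpos

/-- The upper bound of the Courant–Fischer characterization is attained. -/
theorem exists_forall_ker_le_singularValues (T : E →ₗ[ℝ] F) (j : ℕ) :
    ∃ φ : E →ₗ[ℝ] (Fin j → ℝ), ∀ x, φ x = 0 → ‖T x‖ ≤ T.singularValues j * ‖x‖ := by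
  -- `φ` reads the first `j` coordinates in the right singular basis, padded with zeros when `j`
  -- exceeds the dimension.
  refine ⟨{ toFun := fun x i => if hi : (i : ℕ) < finrank ℝ E then
              T.rightSingularBasis.repr x ⟨i, hi⟩ else 0
            map_add' := fun a b => by ext i; simp only [Pi.add_apply]; split_ifs <;> simp
            map_smul' := fun a b => by ext i; simp only [Pi.smul_apply]; split_ifs <;> simp },
          fun x hx => ?_⟩
  have h0 := T.singularValues_nonneg j
  refine le_of_sq_le_sq ?_ (by positivity)
  rw [mul_pow, T.norm_sq_apply_eq_sum_singularValues, T.norm_sq_eq_sum_repr_rightSingularBasis,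
    Finset.mul_sum]
  refine Finset.sum_le_sum fun i _ => ?_
  by_cases hi : (i : ℕ) < j
  · have := congrFun hx ⟨i, hi⟩
    simp at this
    rw [this]; simp
  · have h1 : T.singularValues i ≤ T.singularValues j := T.singularValues_antitone (by omega)
    have h2 := T.singularValues_nonneg i
    gcongr

theorem norm_apply_le_singularValues_zero (T : E →ₗ[ℝ] F) (x : E) :
    ‖T x‖ ≤ T.singularValues 0 * ‖x‖ := by
  obtain ⟨φ, hφ⟩ := T.exists_forall_ker_le_singularValues 0
  exact hφ x (Subsingleton.elim _ _)

theorem singularValues_zero_le (T : E →ₗ[ℝ] F) {c : ℝ} (hc : 0 ≤ c) (h : ∀ x, ‖T x‖ ≤ c * ‖x‖) :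
    T.singularValues 0 ≤ c :=
  T.singularValues_le_of_forall_ker hc (0 : E →ₗ[ℝ] (Fin 0 → ℝ)) (by simp) fun x _ => h x

/-- Weyl's inequality for singular values. -/
theorem singularValues_add_le (S T : E →ₗ[ℝ] F) (i j : ℕ) :
    (S + T).singularValues (i + j) ≤ S.singularValues i + T.singularValues j := by
  obtain ⟨φ, hφ⟩ := S.exists_forall_ker_le_singularValues i
  obtain ⟨ψ, hψ⟩ := T.exists_forall_ker_le_singularValues j
  refine singularValues_le_of_forall_ker _
    (add_nonneg (S.singularValues_nonneg i) (T.singularValues_nonneg j)) (φ.prod ψ) (by simp) ?_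
  intro x hx
  have hx' := Prod.ext_iff.1 hx
  calc ‖(S + T) x‖ ≤ ‖S x‖ + ‖T x‖ := norm_add_le _ _
    _ ≤ _ := by rw [add_mul]; exact add_le_add (hφ x hx'.1) (hψ x hx'.2)

theorem abs_singularValues_sub_le (S T : E →ₗ[ℝ] F) (j : ℕ) :
    |S.singularValues j - T.singularValues j| ≤ (S - T).singularValues 0 := by
  have h1 := singularValues_add_le T (S - T) j 0
  have h3 : (T - S).singularValues 0 ≤ (S - T).singularValues 0 := by
    refine singularValues_zero_le _ ((S - T).singularValues_nonneg 0) fun x => ?_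
    rw [← neg_sub, neg_apply, norm_neg]
    exact norm_apply_le_singularValues_zero _ x
  have h2 := singularValues_add_le S (T - S) j 0
  simp only [add_sub_cancel, add_zero] at h1 h2
  rw [abs_le]
  constructor <;> linarith

theorem sum_sq_singularValues (T : E →ₗ[ℝ] F) {N : ℕ} (hN : finrank ℝ (range T) ≤ N) :
    ∑ j ∈ Finset.range N, T.singularValues j ^ 2 = trace ℝ E (adjoint T ∘ₗ T) := by
  have h1 : ∀ M, finrank ℝ (range T) ≤ M → ∑ j ∈ Finset.range M, T.singularValues j ^ 2
      = ∑ j ∈ Finset.range (finrank ℝ (range T)), T.singularValues j ^ 2 := by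
    intro M hM
    symm
    refine Finset.sum_subset (Finset.range_subset_range.2 hM) fun i _ hi => ?_
    rw [T.singularValues_eq_zero_iff_le_finrank_range.2 (by simpa using hi)]
    simp
  -- Terms beyond the rank vanish, so the sum may be taken up to `dim E`, where it is the sum of the
  -- eigenvalues of `T* T`.
  rw [h1 N hN, ← h1 _ T.finrank_range_le, Finset.sum_range,
    T.isSymmetric_adjoint_comp_self.trace_eq_sum_eigenvalues rfl]
  refine Finset.sum_congr rfl fun i _ => ?_
  rw [T.sq_singularValues_fin rfl]

theorem norm_apply_rightSingularBasis (T : E →ₗ[ℝ] F) (i : Fin (finrank ℝ E)) :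
    ‖T (T.rightSingularBasis i)‖ = T.singularValues i := by
  rw [← sq_eq_sq₀ (norm_nonneg _) (T.singularValues_nonneg i),
    T.norm_sq_apply_eq_sum_singularValues, Finset.sum_eq_single i]
  · simp
  · intro b _ hb
    simp [hb]
  · simp

/-- Trace duality between the operator norm and the nuclear norm, combined with the Cauchy–Schwarz
inequality for the singular values. -/
theorem trace_adjoint_comp_le (S T : E →ₗ[ℝ] F) {c : ℝ} (hT : ∀ x, ‖T x‖ ≤ c * ‖x‖) :
    trace ℝ E (adjoint S ∘ₗ T) ≤ c * ∑ j ∈ Finset.range (finrank ℝ (range S)), S.singularValues j := by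
  have hsum : ∑ j ∈ Finset.range (finrank ℝ (range S)), S.singularValues j
      = ∑ j ∈ Finset.range (finrank ℝ E), S.singularValues j := by
    refine Finset.sum_subset (Finset.range_subset_range.2 S.finrank_range_le) fun i _ hi => ?_
    exact S.singularValues_eq_zero_iff_le_finrank_range.2 (by simpa using hi)
  rw [hsum, Finset.sum_range, trace_eq_sum_inner _ S.rightSingularBasis, Finset.mul_sum]
  refine Finset.sum_le_sum fun i _ => ?_
  rw [comp_apply, adjoint_inner_right]
  refine (real_inner_le_norm _ _).trans ?_
  rw [norm_apply_rightSingularBasis, mul_comm]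
  refine mul_le_mul_of_nonneg_right ?_ (S.singularValues_nonneg i)
  simpa using hT (S.rightSingularBasis i)

end SingularValues

end LinearMap

namespace TraceRegression

/-! ### Transfer to matrices: Schatten norms and the trace scalar product. -/

section Matrices

variable {m₁ m₂ : ℕ}

open LinearMap Module

theorem singularValue_nonneg (A : Matrix (Fin m₁) (Fin m₂) ℝ) (j : ℕ) : 0 ≤ singularValue A j :=
  LinearMap.singularValues_nonneg _ j

theorem singularValue_antitone (A : Matrix (Fin m₁) (Fin m₂) ℝ) : Antitone (singularValue A) :=
  LinearMap.singularValues_antitone _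

theorem finrank_range_toEuclideanLin (A : Matrix (Fin m₁) (Fin m₂) ℝ) :
    finrank ℝ (range (Matrix.toEuclideanLin A)) = A.rank := by
  rw [Matrix.rank_eq_finrank_range_toLin A (EuclideanSpace.basisFun _ ℝ).toBasis
    (EuclideanSpace.basisFun _ ℝ).toBasis, Matrix.toEuclideanLin_eq_toLin_orthonormal]

theorem singularValue_eq_zero_iff (A : Matrix (Fin m₁) (Fin m₂) ℝ) (j : ℕ) :
    singularValue A j = 0 ↔ A.rank ≤ j := by
  rw [← finrank_range_toEuclideanLin]
  exact LinearMap.singularValues_eq_zero_iff_le_finrank_range _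

theorem rank_le_min (A : Matrix (Fin m₁) (Fin m₂) ℝ) : A.rank ≤ min m₁ m₂ :=
  le_min (by simpa using A.rank_le_card_height) (by simpa using A.rank_le_card_width)

theorem abs_singularValue_sub_le (A B : Matrix (Fin m₁) (Fin m₂) ℝ) (j : ℕ) :
    |singularValue A j - singularValue B j| ≤ singularValue (A - B) 0 := by
  simpa [singularValue] using
    abs_singularValues_sub_le (Matrix.toEuclideanLin A) (Matrix.toEuclideanLin B) j

theorem norm_toEuclideanLin_apply_le (A : Matrix (Fin m₁) (Fin m₂) ℝ)
    (x : EuclideanSpace ℝ (Fin m₂)) :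
    ‖Matrix.toEuclideanLin A x‖ ≤ singularValue A 0 * ‖x‖ :=
  LinearMap.norm_apply_le_singularValues_zero _ x

theorem singularValue_sub_zero_le (A B : Matrix (Fin m₁) (Fin m₂) ℝ) :
    singularValue (A - B) 0 ≤ singularValue A 0 + singularValue B 0 := by
  refine LinearMap.singularValues_zero_le _
    (add_nonneg (singularValue_nonneg A 0) (singularValue_nonneg B 0)) fun x => ?_
  rw [map_sub, LinearMap.sub_apply, add_mul]
  exact (norm_sub_le _ _).trans
    (add_le_add (norm_toEuclideanLin_apply_le A x) (norm_toEuclideanLin_apply_le B x))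

theorem singularValue_smul_zero {c : ℝ} (hc : 0 ≤ c) (A : Matrix (Fin m₁) (Fin m₂) ℝ) :
    c * singularValue A 0 ≤ singularValue (c • A) 0 := by
  rcases hc.eq_or_lt with rfl | hc
  · simpa using singularValue_nonneg _ 0
  rw [mul_comm, ← le_div_iff₀ hc]
  refine LinearMap.singularValues_zero_le _
    (div_nonneg (singularValue_nonneg _ 0) hc.le) fun x => ?_
  rw [div_mul_eq_mul_div, le_div_iff₀ hc]
  have := norm_toEuclideanLin_apply_le (c • A) x
  rwa [map_smul, LinearMap.smul_apply, norm_smul, Real.norm_of_nonneg hc.le, mul_comm c] at this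

/-- The approximation property of singular values. -/
theorem singularValue_add_rank_le (Z A : Matrix (Fin m₁) (Fin m₂) ℝ) (j : ℕ) :
    singularValue Z (j + A.rank) ≤ singularValue (Z - A) j := by
  have h := singularValues_add_le (Matrix.toEuclideanLin (Z - A)) (Matrix.toEuclideanLin A) j A.rank
  have h0 : (Matrix.toEuclideanLin A).singularValues A.rank = 0 :=
    (singularValue_eq_zero_iff A A.rank).2 le_rfl
  rw [h0, add_zero, ← map_add, sub_add_cancel] at h
  exact h

theorem matInner_eq_sum (A B : Matrix (Fin m₁) (Fin m₂) ℝ) :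
    matInner A B = ∑ j, ∑ k, A j k * B j k := by
  simp only [matInner, Matrix.trace, Matrix.diag, Matrix.mul_apply, Matrix.transpose_apply]
  exact Finset.sum_comm

theorem matInner_comm (A B : Matrix (Fin m₁) (Fin m₂) ℝ) : matInner A B = matInner B A := by
  simp only [matInner_eq_sum, mul_comm]

theorem matInner_add_left (A B C : Matrix (Fin m₁) (Fin m₂) ℝ) :
    matInner (A + B) C = matInner A C + matInner B C := by
  simp [matInner, Matrix.add_mul]

theorem matInner_sub_left (A B C : Matrix (Fin m₁) (Fin m₂) ℝ) :
    matInner (A - B) C = matInner A C - matInner B C := by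
  simp [matInner, Matrix.sub_mul]

theorem matInner_smul_left (c : ℝ) (A B : Matrix (Fin m₁) (Fin m₂) ℝ) :
    matInner (c • A) B = c * matInner A B := by
  simp [matInner]

theorem matInner_add_right (A B C : Matrix (Fin m₁) (Fin m₂) ℝ) :
    matInner A (B + C) = matInner A B + matInner A C := by
  simp [matInner, Matrix.mul_add]

theorem matInner_sub_right (A B C : Matrix (Fin m₁) (Fin m₂) ℝ) :
    matInner A (B - C) = matInner A B - matInner A C := by
  simp [matInner, Matrix.mul_sub]

theorem matInner_smul_right (c : ℝ) (A B : Matrix (Fin m₁) (Fin m₂) ℝ) :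
    matInner A (c • B) = c * matInner A B := by
  simp [matInner]

theorem matInner_self_nonneg (A : Matrix (Fin m₁) (Fin m₂) ℝ) : 0 ≤ matInner A A := by
  rw [matInner_eq_sum]
  exact Finset.sum_nonneg fun _ _ => Finset.sum_nonneg fun _ _ => mul_self_nonneg _

theorem matInner_self_eq_zero {A : Matrix (Fin m₁) (Fin m₂) ℝ} : matInner A A = 0 ↔ A = 0 := by
  simpa [matInner] using Matrix.trace_conjTranspose_mul_self_eq_zero_iff (A := A)

theorem matInner_sub_self (A B : Matrix (Fin m₁) (Fin m₂) ℝ) :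
    matInner (A - B) (A - B) = matInner A A - 2 * matInner A B + matInner B B := by
  rw [matInner_sub_left, matInner_sub_right, matInner_sub_right, matInner_comm B A]
  ring

theorem matInner_vecMulVec (W : Matrix (Fin m₁) (Fin m₂) ℝ) (y : Fin m₁ → ℝ) (x : Fin m₂ → ℝ) :
    matInner W (Matrix.vecMulVec y x) = y ⬝ᵥ (W *ᵥ x) := by
  simp only [matInner_eq_sum, Matrix.vecMulVec_apply, dotProduct, Matrix.mulVec, Finset.mul_sum]
  exact Finset.sum_congr rfl fun _ _ => Finset.sum_congr rfl fun _ _ => by ring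

theorem matInner_eq_trace (A B : Matrix (Fin m₁) (Fin m₂) ℝ) :
    matInner A B = LinearMap.trace ℝ _
      (adjoint (Matrix.toEuclideanLin A) ∘ₗ Matrix.toEuclideanLin B) := by
  rw [← Matrix.toEuclideanLin_conjTranspose_eq_adjoint, Matrix.toEuclideanLin_eq_toLin_orthonormal,
    Matrix.toEuclideanLin_eq_toLin_orthonormal,
    ← Matrix.toLin_mul, Matrix.trace_toLin_eq, matInner, Matrix.conjTranspose_eq_transpose_of_trivial]

theorem sum_sq_singularValue (A : Matrix (Fin m₁) (Fin m₂) ℝ) {N : ℕ} (hN : A.rank ≤ N) :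
    ∑ j ∈ Finset.range N, singularValue A j ^ 2 = matInner A A := by
  rw [matInner_eq_trace]
  exact sum_sq_singularValues _ (by rwa [finrank_range_toEuclideanLin])

theorem schattenNorm_two_sq (A : Matrix (Fin m₁) (Fin m₂) ℝ) :
    schattenNorm 2 A ^ 2 = matInner A A := by
  rw [← sum_sq_singularValue A (rank_le_min A), schattenNorm, if_neg (by simp)]
  have h : 0 ≤ ∑ j ∈ Finset.range (min m₁ m₂), singularValue A j ^ 2 :=
    Finset.sum_nonneg fun _ _ => sq_nonneg _
  rw [← Real.rpow_natCast, ← Real.rpow_mul]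
  · simp
  · simpa using h

/-- Trace duality bounds the product by the nuclear norm of `D`; Cauchy–Schwarz over its at most `r`
nonzero singular values brings in the Frobenius norm. -/
theorem matInner_le_singularValue_mul_sqrt (D W : Matrix (Fin m₁) (Fin m₂) ℝ) {r : ℕ} (hr : D.rank ≤ r) :
    matInner D W ≤ singularValue W 0 * Real.sqrt (r * matInner D D) := by
  rw [matInner_eq_trace]
  refine (trace_adjoint_comp_le _ _ (norm_toEuclideanLin_apply_le W)).trans ?_
  refine mul_le_mul_of_nonneg_left (Real.le_sqrt_of_sq_le ?_) (singularValue_nonneg W 0)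
  rw [finrank_range_toEuclideanLin]
  refine sq_sum_le_card_mul_sum_sq.trans ?_
  rw [Finset.card_range]
  have h := sum_sq_singularValue D le_rfl
  simp only [singularValue] at h
  rw [h]
  gcongr
  exact matInner_self_nonneg D

end Matrices

end TraceRegression

namespace TraceRegression

/-! ### Reduction of the statistical model to a deterministic problem. -/

section UniformSampling

variable {Ω : Type*} [MeasurableSpace Ω] {n m₁ m₂ : ℕ}

instance instMeasurableSingletonClassMatrix :
    MeasurableSingletonClass (Matrix (Fin m₁) (Fin m₂) ℝ) :=
  inferInstanceAs (MeasurableSingletonClass (Fin m₁ → Fin m₂ → ℝ))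

theorem measurable_entry (j : Fin m₁) (k : Fin m₂) :
    Measurable fun x : Matrix (Fin m₁) (Fin m₂) ℝ => x j k :=
  (measurable_pi_apply k).comp (measurable_pi_apply (X := fun _ : Fin m₁ => Fin m₂ → ℝ) j)

theorem measurable_matInner (A : Matrix (Fin m₁) (Fin m₂) ℝ) :
    Measurable fun x => matInner A x := by
  simp only [matInner_eq_sum]
  exact Finset.measurable_sum _ fun j _ => Finset.measurable_sum _ fun k _ =>
    (measurable_entry j k).const_mul _

theorem matInner_single (A : Matrix (Fin m₁) (Fin m₂) ℝ) (p : Fin m₁ × Fin m₂) :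
    matInner A (Matrix.single p.1 p.2 1) = A p.1 p.2 := by
  rw [matInner_eq_sum, Finset.sum_eq_single p.1, Finset.sum_eq_single p.2]
  · simp
  · intro b _ hb; simp [hb.symm]
  · simp
  · intro b _ hb; simp [hb.symm]
  · simp

theorem single_one_injective : Function.Injective
    fun p : Fin m₁ × Fin m₂ => Matrix.single p.1 p.2 (1 : ℝ) := by
  rintro ⟨a, b⟩ ⟨c, d⟩ h
  have := congrFun (congrFun h a) b
  simp [Matrix.single_apply] at this
  simp [this]

theorem integral_uniformOn_entryBasis (g : Matrix (Fin m₁) (Fin m₂) ℝ → ℝ) :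
    ∫ x, g x ∂(uniformOn (entryBasis m₁ m₂))
      = ((m₁ : ℝ) * m₂)⁻¹ * ∑ j, ∑ k, g (Matrix.single j k 1) := by
  classical
  have hS : entryBasis m₁ m₂ = ((Finset.univ.map ⟨_, single_one_injective⟩ :
      Finset (Matrix (Fin m₁) (Fin m₂) ℝ)) : Set (Matrix (Fin m₁) (Fin m₂) ℝ)) := by
    simp [entryBasis]
  rw [uniformOn, ProbabilityTheory.cond, integral_smul_measure, hS, setIntegral_finset,
    Measure.count_apply_finset]
  · simp [Finset.sum_map, Fintype.sum_prod_type]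
  · rw [← Set.biUnion_of_singleton (SetLike.coe _)]
    exact integrableOn_finset_iUnion.2 fun _ _ => integrableOn_singleton (hx := by simp)

variable {P : Measure Ω} {X : Fin n → Ω → Matrix (Fin m₁) (Fin m₂) ℝ} {Y : Fin n → Ω → ℝ}
  {A₀ : Matrix (Fin m₁) (Fin m₂) ℝ}

theorem IsUSR.integral_comp (hUSR : IsUSR P X) {i : Fin n} (hX : Measurable (X i))
    {g : Matrix (Fin m₁) (Fin m₂) ℝ → ℝ} (hg : Measurable g) :
    ∫ ω, g (X i ω) ∂P = ((m₁ : ℝ) * m₂)⁻¹ * ∑ j, ∑ k, g (Matrix.single j k 1) := by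
  rw [← integral_uniformOn_entryBasis, ← hUSR i,
    integral_map hX.aemeasurable hg.aestronglyMeasurable]

theorem IsUSR.sqNormPi_eq (hUSR : IsUSR P X) (hX : ∀ i, Measurable (X i)) (hn : 0 < n)
    (A : Matrix (Fin m₁) (Fin m₂) ℝ) :
    sqNormPi P X A = ((m₁ : ℝ) * m₂)⁻¹ * matInner A A := by
  have h : ∀ i, ∫ ω, matInner A (X i ω) * matInner A (X i ω) ∂P
      = ((m₁ : ℝ) * m₂)⁻¹ * matInner A A := by
    intro i
    rw [hUSR.integral_comp (hX i) (g := fun x => matInner A x * matInner A x)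
      ((measurable_matInner A).mul (measurable_matInner A)), matInner_eq_sum A A]
    simp only [fun j k => matInner_single A (j, k)]
  have hn' : (n : ℝ) ≠ 0 := by positivity
  rw [sqNormPi, innerPi]
  simp only [h, Finset.sum_const, Finset.card_univ, Fintype.card_fin, nsmul_eq_mul]
  field_simp

theorem IsUSR.ae_norm_entry_le (hUSR : IsUSR P X) {i : Fin n} (hX : Measurable (X i))
    (j : Fin m₁) (k : Fin m₂) : ∀ᵐ ω ∂P, ‖X i ω j k‖ ≤ 1 := by
  have hfin : (entryBasis m₁ m₂).Finite := Set.finite_range _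
  have h : ∀ᵐ x ∂(P.map (X i)), x ∈ entryBasis m₁ m₂ := by
    rw [hUSR i]
    exact ae_cond_mem hfin.measurableSet
  filter_upwards [ae_of_ae_map hX.aemeasurable h] with ω hω
  obtain ⟨p, hp⟩ := hω
  rw [← hp]
  simp only [Matrix.single_apply]
  split_ifs <;> simp

/-- Conditioning on `X i` pulls out the entry, which is a.s. bounded by 1, and replaces `Y i` by
`⟨A₀, X i⟩`; the uniform average then retains only the `(j, k)` term. -/
theorem IsTraceRegression.integral_mul_entry [IsProbabilityMeasure P]
    (hmodel : IsTraceRegression P X Y A₀) (hUSR : IsUSR P X) (i : Fin n)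
    (j : Fin m₁) (k : Fin m₂) :
    ∫ ω, Y i ω * X i ω j k ∂P = ((m₁ : ℝ) * m₂)⁻¹ * A₀ j k := by
  have hX := hmodel.measurable_X i
  have hm := hX.comap_le
  have hsm : StronglyMeasurable[MeasurableSpace.comap (X i) inferInstance] fun ω => X i ω j k :=
    ((measurable_entry j k).comp (comap_measurable (X i))).stronglyMeasurable
  have hce := condExp_stronglyMeasurable_mul_of_bound hm hsm (hmodel.integrable_Y i) 1
    (hUSR.ae_norm_entry_le hX j k)
  calc ∫ ω, Y i ω * X i ω j k ∂P
      = ∫ ω, ((fun ω => X i ω j k) * Y i) ω ∂P := by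
        simp only [Pi.mul_apply, mul_comm]
    _ = ∫ ω, (P[(fun ω => X i ω j k) * Y i | MeasurableSpace.comap (X i) inferInstance]) ω ∂P :=
        (integral_condExp hm).symm
    _ = ∫ ω, X i ω j k * matInner A₀ (X i ω) ∂P := by
        refine integral_congr_ae ?_
        filter_upwards [hce, hmodel.condExp_Y i] with ω h1 h2
        rw [h1, Pi.mul_apply, h2, matInner_comm, matInner]
    _ = ((m₁ : ℝ) * m₂)⁻¹ * A₀ j k := by
        rw [hUSR.integral_comp hX (g := fun x => x j k * matInner A₀ x)
          ((measurable_entry j k).mul (measurable_matInner A₀))]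
        simp only [fun a b => matInner_single A₀ (a, b)]
        congr 1
        rw [Finset.sum_eq_single j, Finset.sum_eq_single k]
        · simp
        · intro b _ hb; simp [hb]
        · simp
        · intro b _ hb; simp [hb]
        · simp

theorem IsTraceRegression.noiseMatrix_eq [IsProbabilityMeasure P]
    (hmodel : IsTraceRegression P X Y A₀) (hUSR : IsUSR P X) (hn : 0 < n) (hm₁ : 0 < m₁)
    (hm₂ : 0 < m₂) (ω : Ω) :
    noiseMatrix P X Y ω = ((m₁ : ℝ) * m₂)⁻¹ • (dataMatrix X Y ω - A₀) := by
  have hn' : (n : ℝ) ≠ 0 := by positivity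
  have h1 : (m₁ : ℝ) ≠ 0 := by positivity
  have h2 : (m₂ : ℝ) ≠ 0 := by positivity
  ext j k
  simp only [noiseMatrix, dataMatrix, hmodel.integral_mul_entry hUSR, Finset.sum_sub_distrib,
    Matrix.smul_apply, Matrix.sub_apply, Matrix.of_apply, Finset.sum_const, Finset.card_univ,
    Fintype.card_fin, smul_eq_mul, nsmul_eq_mul]
  field_simp

theorem IsUSR.criterion_eq (hUSR : IsUSR P X) (hX : ∀ i, Measurable (X i)) (hn : 0 < n)
    (hm₁ : 0 < m₁) (hm₂ : 0 < m₂) (lam : ℝ) (ω : Ω) (A : Matrix (Fin m₁) (Fin m₂) ℝ) :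
    criterion P X Y lam ω A = ((m₁ : ℝ) * m₂)⁻¹ *
      (matInner (dataMatrix X Y ω - A) (dataMatrix X Y ω - A) + lam * m₁ * m₂ * A.rank
        - matInner (dataMatrix X Y ω) (dataMatrix X Y ω)) := by
  have hn' : (n : ℝ) ≠ 0 := by positivity
  have h1 : (m₁ : ℝ) ≠ 0 := by positivity
  have h2 : (m₂ : ℝ) ≠ 0 := by positivity
  have hdata : (2 / (n : ℝ)) • ∑ i, Y i ω • X i ω
      = (2 * ((m₁ : ℝ) * m₂)⁻¹) • dataMatrix X Y ω := by
    rw [dataMatrix, smul_smul]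
    congr 1
    field_simp
  rw [criterion, hdata, hUSR.sqNormPi_eq hX hn, matInner_smul_left, matInner_sub_self]
  field_simp
  ring

/-- Under uniform sampling, the rank penalized estimators are the minimizers of the rank penalized
Frobenius distance to the data matrix. -/
theorem IsUSR.isRankPenalizedEstimator_iff (hUSR : IsUSR P X) (hX : ∀ i, Measurable (X i))
    (hn : 0 < n) (hm₁ : 0 < m₁) (hm₂ : 0 < m₂) (lam : ℝ) (ω : Ω)
    (B : Matrix (Fin m₁) (Fin m₂) ℝ) :
    IsRankPenalizedEstimator P X Y lam ω B ↔ ∀ A : Matrix (Fin m₁) (Fin m₂) ℝ,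
      matInner (dataMatrix X Y ω - B) (dataMatrix X Y ω - B) + lam * m₁ * m₂ * B.rank ≤
        matInner (dataMatrix X Y ω - A) (dataMatrix X Y ω - A) + lam * m₁ * m₂ * A.rank := by
  have h : 0 < ((m₁ : ℝ) * m₂)⁻¹ := by positivity
  refine forall_congr' fun A => ?_
  rw [hUSR.criterion_eq hX hn hm₁ hm₂, hUSR.criterion_eq hX hn hm₁ hm₂, mul_le_mul_iff_right₀ h]
  constructor <;> intro h <;> linarith

/-- A one-entry matrix is a sufficient test, since `‖·‖²_{L₂(Π)}` is an exact multiple of the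
squared Frobenius norm. -/
theorem IsUSR.mul_le_sq_of_lowerIsometry (hUSR : IsUSR P X) (hX : ∀ i, Measurable (X i))
    (hn : 0 < n) (hm₁ : 0 < m₁) (hm₂ : 0 < m₂) {μ : ℝ} (hμ : LowerIsometry P X μ) :
    (m₁ : ℝ) * m₂ ≤ μ ^ 2 := by
  have h := hμ.2 (Matrix.single ⟨0, hm₁⟩ ⟨0, hm₂⟩ 1)
  have h0 := hμ.1
  rw [hUSR.sqNormPi_eq hX hn, schattenNorm_two_sq,
    matInner_single _ (⟨0, hm₁⟩, ⟨0, hm₂⟩), Matrix.single_apply_same, mul_one, mul_one] at h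
  exact (inv_le_inv₀ (by positivity) (by positivity)).1 h

end UniformSampling

end TraceRegression

namespace TraceRegression

/-! ### The deterministic rank penalized approximation problem. -/

section RankPenalty

variable {m₁ m₂ : ℕ}

/-- The minimizers of the rank penalized squared Frobenius distance to `Z`, at level `t`. -/
def IsRankPenalizedProjection (Z : Matrix (Fin m₁) (Fin m₂) ℝ) (t : ℝ)
    (B : Matrix (Fin m₁) (Fin m₂) ℝ) : Prop :=
  ∀ A : Matrix (Fin m₁) (Fin m₂) ℝ,
    matInner (Z - B) (Z - B) + t ^ 2 * B.rank ≤ matInner (Z - A) (Z - A) + t ^ 2 * A.rank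

/-- Weyl's inequality at the index `A.rank + B.rank`, where both terms on the right vanish. -/
theorem rank_add_le_rank_add_rank (A B : Matrix (Fin m₁) (Fin m₂) ℝ) :
    (A + B).rank ≤ A.rank + B.rank := by
  have h := LinearMap.singularValues_add_le (Matrix.toEuclideanLin A) (Matrix.toEuclideanLin B)
    A.rank B.rank
  have hA : (Matrix.toEuclideanLin A).singularValues A.rank = 0 :=
    (singularValue_eq_zero_iff A A.rank).2 le_rfl
  have hB : (Matrix.toEuclideanLin B).singularValues B.rank = 0 :=
    (singularValue_eq_zero_iff B B.rank).2 le_rfl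
  rw [hA, hB, add_zero, ← map_add] at h
  exact (singularValue_eq_zero_iff _ _).1 (le_antisymm h (singularValue_nonneg _ _))

theorem rank_neg_le (A : Matrix (Fin m₁) (Fin m₂) ℝ) : (-A).rank ≤ A.rank := by
  have h := Matrix.rank_mul_le_left A (-1 : Matrix (Fin m₂) (Fin m₂) ℝ)
  rwa [Matrix.mul_neg, Matrix.mul_one] at h

theorem rank_sum_vecMulVec_le {ι : Type*} (s : Finset ι) (c : ι → ℝ) (u : ι → Fin m₁ → ℝ)
    (v : ι → Fin m₂ → ℝ) : (∑ j ∈ s, c j • Matrix.vecMulVec (u j) (v j)).rank ≤ s.card := by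
  classical
  induction s using Finset.induction_on with
  | empty => simp
  | insert a s ha ih =>
    rw [Finset.sum_insert ha, Finset.card_insert_of_notMem ha, add_comm s.card,
      ← Matrix.smul_vecMulVec]
    exact (rank_add_le_rank_add_rank _ _).trans (add_le_add (Matrix.rank_vecMulVec_le _ _) ih)

/-- Eckart–Young–Mirsky lower bound for the rank penalized criterion. -/
theorem sum_min_sq_singularValue_le (Z A : Matrix (Fin m₁) (Fin m₂) ℝ) (t : ℝ) :
    ∑ j ∈ Finset.range Z.rank, min (singularValue Z j ^ 2) (t ^ 2)
      ≤ matInner (Z - A) (Z - A) + t ^ 2 * A.rank := by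
  set N := max Z.rank (Z - A).rank
  calc ∑ j ∈ Finset.range Z.rank, min (singularValue Z j ^ 2) (t ^ 2)
      ≤ ∑ j ∈ Finset.range (A.rank + N), min (singularValue Z j ^ 2) (t ^ 2) := by
        refine Finset.sum_le_sum_of_subset_of_nonneg (Finset.range_subset_range.2 ?_)
          fun _ _ _ => le_min (sq_nonneg _) (sq_nonneg _)
        exact (le_max_left _ _).trans (Nat.le_add_left _ _)
    _ = ∑ j ∈ Finset.range A.rank, min (singularValue Z j ^ 2) (t ^ 2)
        + ∑ j ∈ Finset.range N, min (singularValue Z (A.rank + j) ^ 2) (t ^ 2) :=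
        Finset.sum_range_add _ _ _
    -- The first `rank A` terms are paid for by the penalty, the others by the squared distance,
    -- through `σ_{j + rank A}(Z) ≤ σ_j(Z - A)`.
    _ ≤ ∑ _j ∈ Finset.range A.rank, t ^ 2
        + ∑ j ∈ Finset.range N, singularValue (Z - A) j ^ 2 := by
        refine add_le_add (Finset.sum_le_sum fun j _ => min_le_right _ _)
          (Finset.sum_le_sum fun j _ => (min_le_left _ _).trans ?_)
        rw [add_comm]
        have := singularValue_nonneg Z (j + A.rank)
        gcongr
        exact singularValue_add_rank_le Z A j
    _ = matInner (Z - A) (Z - A) + t ^ 2 * A.rank := by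
        rw [sum_sq_singularValue _ (le_max_right _ _)]
        simp
        ring

theorem matInner_vecMulVec_vecMulVec (a c : Fin m₁ → ℝ) (b d : Fin m₂ → ℝ) :
    matInner (Matrix.vecMulVec a b) (Matrix.vecMulVec c d) = (a ⬝ᵥ c) * (b ⬝ᵥ d) := by
  simp only [matInner_eq_sum, Matrix.vecMulVec_apply, dotProduct, Finset.sum_mul_sum]
  exact Finset.sum_congr rfl fun _ _ => Finset.sum_congr rfl fun _ _ => by ring

theorem matInner_sum_smul_vecMulVec_self {ι : Type*} [Fintype ι] [DecidableEq ι]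
    {u : ι → EuclideanSpace ℝ (Fin m₁)} {v : ι → EuclideanSpace ℝ (Fin m₂)}
    (hu : Orthonormal ℝ u) (hv : Orthonormal ℝ v) (c : ι → ℝ) :
    matInner (∑ j, c j • Matrix.vecMulVec (u j).ofLp (v j).ofLp)
      (∑ j, c j • Matrix.vecMulVec (u j).ofLp (v j).ofLp) = ∑ j, c j ^ 2 := by
  have hL : ∀ (C : Matrix (Fin m₁) (Fin m₂) ℝ) (D : ι → Matrix (Fin m₁) (Fin m₂) ℝ),
      matInner (∑ j, D j) C = ∑ j, matInner (D j) C := fun C D =>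
    map_sum (⟨⟨fun B => matInner B C, by simp [matInner]⟩, fun A B => matInner_add_left A B C⟩ :
      Matrix (Fin m₁) (Fin m₂) ℝ →+ ℝ) D _
  have hdot : ∀ {m : ℕ} {w : ι → EuclideanSpace ℝ (Fin m)}, Orthonormal ℝ w → ∀ i j,
      (w i).ofLp ⬝ᵥ (w j).ofLp = if i = j then 1 else 0 := by
    intro m w hw i j
    rw [← orthonormal_iff_ite.1 hw i j, EuclideanSpace.inner_eq_star_dotProduct, dotProduct_comm]
    simp
  rw [hL]
  refine Finset.sum_congr rfl fun i _ => ?_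
  rw [matInner_comm, hL, Finset.sum_eq_single i]
  · rw [matInner_smul_left, matInner_smul_right, matInner_vecMulVec_vecMulVec, hdot hu, hdot hv]
    simp [sq]
  · intro b _ hb
    rw [matInner_smul_left, matInner_smul_right, matInner_vecMulVec_vecMulVec, hdot hu]
    simp [hb]
  · simp

/-- The Eckart–Young bound is attained term by term: a kept singular value costs at most `t²`, a
dropped one costs its square. -/
theorem IsHardThresholding.isRankPenalizedProjection {Z B : Matrix (Fin m₁) (Fin m₂) ℝ} {t : ℝ}
    (ht : 0 ≤ t) (h : IsHardThresholding Z t B) : IsRankPenalizedProjection Z t B := by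
  obtain ⟨u, v, hu, hv, hZ, hB⟩ := h
  intro A
  refine le_trans ?_ (sum_min_sq_singularValue_le Z A t)
  have hrank : B.rank ≤ (Finset.univ.filter fun j : Fin Z.rank => t ≤ singularValue Z j).card := by
    rw [hB, ← Finset.sum_filter]
    exact rank_sum_vecMulVec_le _ _ _ _
  have hsub : Z - B = ∑ j : Fin Z.rank, (if t ≤ singularValue Z j then 0 else singularValue Z j) •
      Matrix.vecMulVec (u j).ofLp (v j).ofLp := by
    have : Z - B = (∑ j : Fin Z.rank, singularValue Z j • Matrix.vecMulVec (u j).ofLp (v j).ofLp)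
        - B := by rw [← hZ]
    rw [this, hB, ← Finset.sum_sub_distrib]
    refine Finset.sum_congr rfl fun j _ => ?_
    split_ifs <;> simp
  rw [hsub, matInner_sum_smul_vecMulVec_self hu hv, Finset.sum_range]
  calc _ ≤ ∑ j : Fin Z.rank, (if t ≤ singularValue Z j then 0 else singularValue Z j) ^ 2
        + t ^ 2 * ((Finset.univ.filter fun j : Fin Z.rank => t ≤ singularValue Z j).card : ℝ) := by
        gcongr
    _ = ∑ j : Fin Z.rank, min (singularValue Z j ^ 2) (t ^ 2) := by
        rw [Finset.card_filter, Nat.cast_sum, Finset.mul_sum, ← Finset.sum_add_distrib]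
        refine Finset.sum_congr rfl fun j _ => ?_
        have h0 := singularValue_nonneg Z j
        split_ifs with hj
        · rw [min_eq_right (by gcongr)]; simp
        · rw [min_eq_left (by push Not at hj; gcongr)]; simp

theorem eq_zero_of_forall_le_add_sq {a b : ℝ} (h : ∀ s : ℝ, 0 ≤ s * a + s ^ 2 * b) : a = 0 := by
  by_contra ha
  have ha2 : 0 < a ^ 2 := by positivity
  have hb : 0 < |b| + 1 := by positivity
  -- Dividing by `|b| + 1 > b` lets the linear term dominate, so the value is negative unless `a =
  -- 0`.
  have h1 := h (-a / (|b| + 1))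
  have h2 : -a / (|b| + 1) * a + (-a / (|b| + 1)) ^ 2 * b
      = a ^ 2 / (|b| + 1) ^ 2 * (b - (|b| + 1)) := by
    field_simp
    ring
  rw [h2] at h1
  have h3 : b - (|b| + 1) < 0 := by linarith [le_abs_self b]
  have h4 : 0 < a ^ 2 / (|b| + 1) ^ 2 := by positivity
  exact absurd h1 (not_le.2 (mul_neg_of_pos_of_neg h4 h3))

namespace IsRankPenalizedProjection

variable {Z B : Matrix (Fin m₁) (Fin m₂) ℝ} {t : ℝ}

/-- First variation: along a line on which the rank does not exceed that of `B`, the squared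
distance itself is minimal at `s = 0`. -/
theorem matInner_residual_eq_zero (h : IsRankPenalizedProjection Z t B)
    {D : Matrix (Fin m₁) (Fin m₂) ℝ} (hD : ∀ s : ℝ, (B + s • D).rank ≤ B.rank) :
    matInner (Z - B) D = 0 := by
  have key : -2 * matInner (Z - B) D = 0 := by
    refine eq_zero_of_forall_le_add_sq (b := matInner D D) fun s => ?_
    have h1 := h (B + s • D)
    have h2 : (((B + s • D).rank : ℕ) : ℝ) ≤ B.rank := by exact_mod_cast hD s
    have h3 : t ^ 2 * ((B + s • D).rank : ℝ) ≤ t ^ 2 * B.rank := by gcongr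
    rw [← sub_sub, matInner_sub_self (Z - B), matInner_smul_left, matInner_smul_right,
      matInner_smul_right] at h1
    linarith
  linarith

/-- The direction `B Bᵀ(Z - B)` only multiplies `B` on the right, so the rank cannot grow, and its
product with the residual is `‖Bᵀ(Z - B)‖₂²`. -/
theorem transpose_mul_residual (h : IsRankPenalizedProjection Z t B) : Bᵀ * (Z - B) = 0 := by
  have h1 : matInner (Z - B) (B * (Bᵀ * (Z - B))) = 0 := by
    refine h.matInner_residual_eq_zero fun s => ?_
    have : B + s • (B * (Bᵀ * (Z - B))) = B * (1 + s • (Bᵀ * (Z - B))) := by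
      rw [Matrix.mul_add, Matrix.mul_one, Matrix.mul_smul]
    rw [this]
    exact Matrix.rank_mul_le_left _ _
  rw [← matInner_self_eq_zero, ← h1, matInner, matInner, Matrix.transpose_mul,
    Matrix.transpose_transpose, Matrix.mul_assoc]

theorem residual_mul_transpose (h : IsRankPenalizedProjection Z t B) : (Z - B) * Bᵀ = 0 := by
  have h1 : matInner (Z - B) (((Z - B) * Bᵀ) * B) = 0 := by
    refine h.matInner_residual_eq_zero fun s => ?_
    have : B + s • (((Z - B) * Bᵀ) * B) = (1 + s • ((Z - B) * Bᵀ)) * B := by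
      rw [Matrix.add_mul, Matrix.one_mul, Matrix.smul_mul]
    rw [this]
    exact Matrix.rank_mul_le_right _ _
  rw [← matInner_self_eq_zero, ← h1, matInner, matInner, Matrix.transpose_mul,
    Matrix.transpose_transpose, Matrix.mul_assoc, Matrix.trace_mul_comm]
  simp only [Matrix.mul_assoc]

end IsRankPenalizedProjection

theorem norm_sq_toEuclideanLin_apply (A : Matrix (Fin m₁) (Fin m₂) ℝ)
    (x : EuclideanSpace ℝ (Fin m₂)) :
    ‖Matrix.toEuclideanLin A x‖ ^ 2 = (A *ᵥ x.ofLp) ⬝ᵥ (A *ᵥ x.ofLp) := by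
  rw [← real_inner_self_eq_norm_sq, EuclideanSpace.inner_eq_star_dotProduct]
  simp

theorem norm_sq_eq_dotProduct {m : ℕ} (x : EuclideanSpace ℝ (Fin m)) :
    ‖x‖ ^ 2 = x.ofLp ⬝ᵥ x.ofLp := by
  rw [← real_inner_self_eq_norm_sq, EuclideanSpace.inner_eq_star_dotProduct]
  simp

theorem toEuclideanLin_mul_apply {m₃ : ℕ} (A : Matrix (Fin m₁) (Fin m₂) ℝ)
    (C : Matrix (Fin m₂) (Fin m₃) ℝ) (x : EuclideanSpace ℝ (Fin m₃)) :
    Matrix.toEuclideanLin (A * C) x = Matrix.toEuclideanLin A (Matrix.toEuclideanLin C x) := by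
  ext i
  simp

theorem inner_toEuclideanLin_left (A : Matrix (Fin m₁) (Fin m₂) ℝ)
    (x : EuclideanSpace ℝ (Fin m₂)) (y : EuclideanSpace ℝ (Fin m₁)) :
    inner ℝ (Matrix.toEuclideanLin A x) y = inner ℝ x (Matrix.toEuclideanLin Aᵀ y) := by
  rw [← Matrix.conjTranspose_eq_transpose_of_trivial,
    Matrix.toEuclideanLin_conjTranspose_eq_adjoint, LinearMap.adjoint_inner_right]

/-- The subtraction composes `B` with the projection off `v`. As `v` lies in the row space, it is
orthogonal to `ker B`: the kernel keeps all its vectors and gains `v`. -/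
theorem rank_sub_smul_vecMulVec_lt {B : Matrix (Fin m₁) (Fin m₂) ℝ} {w : Fin m₁ → ℝ}
    {v : Fin m₂ → ℝ} (hv : v = Bᵀ *ᵥ w) (hv0 : v ≠ 0) :
    (B - (v ⬝ᵥ v)⁻¹ • Matrix.vecMulVec (B *ᵥ v) v).rank < B.rank := by
  set D := (v ⬝ᵥ v)⁻¹ • Matrix.vecMulVec (B *ᵥ v) v with hD
  have hvv : v ⬝ᵥ v ≠ 0 := by simpa [dotProduct_self_eq_zero] using hv0
  have hDx : ∀ x, D *ᵥ x = ((v ⬝ᵥ v)⁻¹ * (v ⬝ᵥ x)) • (B *ᵥ v) := by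
    intro x
    rw [hD, Matrix.smul_mulVec, Matrix.vecMulVec_mulVec]
    simp [smul_smul]
  have horth : ∀ x, B *ᵥ x = 0 → v ⬝ᵥ x = 0 := by
    intro x hx
    rw [hv, dotProduct_comm, Matrix.dotProduct_mulVec, Matrix.vecMul_transpose, hx,
      zero_dotProduct]
  have hlt : LinearMap.ker B.mulVecLin < LinearMap.ker (B - D).mulVecLin := by
    refine lt_of_le_of_ne (fun x hx => ?_) fun h => ?_
    · have hx : B *ᵥ x = 0 := hx
      change (B - D) *ᵥ x = 0
      rw [Matrix.sub_mulVec, hDx, hx, horth x hx]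
      simp
    · have hmem : v ∈ LinearMap.ker (B - D).mulVecLin := by
        change (B - D) *ᵥ v = 0
        rw [Matrix.sub_mulVec, hDx, inv_mul_cancel₀ hvv, one_smul, sub_self]
      rw [← h] at hmem
      exact hvv (horth v hmem)
  have h1 := Submodule.finrank_lt_finrank_of_lt hlt
  have h2 := B.mulVecLin.finrank_range_add_finrank_ker
  have h3 := (B - D).mulVecLin.finrank_range_add_finrank_ker
  rw [Matrix.rank, Matrix.rank]
  omega

theorem matInner_smul_vecMulVec_self (y : Fin m₁ → ℝ)
    {x : Fin m₂ → ℝ} (hx : x ≠ 0) :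
    matInner ((x ⬝ᵥ x)⁻¹ • Matrix.vecMulVec y x) ((x ⬝ᵥ x)⁻¹ • Matrix.vecMulVec y x)
      = (x ⬝ᵥ x)⁻¹ * (y ⬝ᵥ y) := by
  have hxx : x ⬝ᵥ x ≠ 0 := by simpa [dotProduct_self_eq_zero] using hx
  rw [matInner_smul_left, matInner_smul_right, matInner_vecMulVec_vecMulVec]
  field_simp

namespace IsRankPenalizedProjection

variable {Z B : Matrix (Fin m₁) (Fin m₂) ℝ} {t : ℝ}

/-- Adding `(Z - B)x xᵀ / ‖x‖²` to `B` costs at most `t²` in penalty and lowers the squared distance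
by `‖(Z - B)x‖² / ‖x‖²`. -/
theorem norm_residual_apply_le (h : IsRankPenalizedProjection Z t B) (ht : 0 ≤ t)
    (x : EuclideanSpace ℝ (Fin m₂)) : ‖Matrix.toEuclideanLin (Z - B) x‖ ≤ t * ‖x‖ := by
  refine le_of_sq_le_sq ?_ (by positivity)
  rw [mul_pow, norm_sq_toEuclideanLin_apply, norm_sq_eq_dotProduct]
  generalize x.ofLp = x
  by_cases hx : x = 0
  · simp [hx]
  have hxx : 0 < x ⬝ᵥ x := lt_of_le_of_ne (by simpa using dotProduct_star_self_nonneg x)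
    (Ne.symm (by simpa [dotProduct_self_eq_zero] using hx))
  set y := (Z - B) *ᵥ x with hy
  set D := (x ⬝ᵥ x)⁻¹ • Matrix.vecMulVec y x with hD
  have h1 := h (B + D)
  have h2 : (B + D).rank ≤ B.rank + 1 := by
    refine (rank_add_le_rank_add_rank _ _).trans (Nat.add_le_add_left ?_ _)
    rw [hD, ← Matrix.smul_vecMulVec]
    exact Matrix.rank_vecMulVec_le _ _
  have h3 : ((B + D).rank : ℝ) ≤ B.rank + 1 := by exact_mod_cast h2
  have h4 : t ^ 2 * ((B + D).rank : ℝ) ≤ t ^ 2 * (B.rank + 1) := by gcongr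
  rw [← sub_sub, matInner_sub_self (Z - B), hD, matInner_smul_vecMulVec_self y hx,
    matInner_smul_right, matInner_vecMulVec, ← hy] at h1
  have h5 : (x ⬝ᵥ x)⁻¹ * (y ⬝ᵥ y) ≤ t ^ 2 := by linarith
  rwa [inv_mul_le_iff₀ hxx, mul_comm] at h5

theorem residual_mulVec_eq_zero (h : IsRankPenalizedProjection Z t B) (w : Fin m₁ → ℝ) :
    (Z - B) *ᵥ (Bᵀ *ᵥ w) = 0 := by
  rw [Matrix.mulVec_mulVec, h.residual_mul_transpose, Matrix.zero_mulVec]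

/-- Removing `Bv vᵀ / ‖v‖²` with `v` in the row space saves at least `t²` in penalty. As the
residual kills `v`, the squared distance grows by exactly `‖Bv‖² / ‖v‖²`. -/
theorem le_norm_apply (h : IsRankPenalizedProjection Z t B)
    {x : EuclideanSpace ℝ (Fin m₂)} (hx : x ∈ LinearMap.range (Matrix.toEuclideanLin Bᵀ)) :
    t * ‖x‖ ≤ ‖Matrix.toEuclideanLin B x‖ := by
  obtain ⟨w, hw⟩ := hx
  refine le_of_sq_le_sq ?_ (norm_nonneg _)
  rw [mul_pow, norm_sq_toEuclideanLin_apply, norm_sq_eq_dotProduct]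
  have hv : x.ofLp = Bᵀ *ᵥ w.ofLp := by rw [← hw]; simp
  generalize x.ofLp = v at hv ⊢
  by_cases hv0 : v = 0
  · simp [hv0]
  have hvv : 0 < v ⬝ᵥ v := lt_of_le_of_ne (by simpa using dotProduct_star_self_nonneg v)
    (Ne.symm (by simpa [dotProduct_self_eq_zero] using hv0))
  have h2 := rank_sub_smul_vecMulVec_lt hv hv0
  set D := (v ⬝ᵥ v)⁻¹ • Matrix.vecMulVec (B *ᵥ v) v with hD
  have h1 := h (B - D)
  have h3 : ((B - D).rank : ℝ) + 1 ≤ B.rank := by exact_mod_cast h2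
  have h4 : t ^ 2 * (((B - D).rank : ℝ) + 1) ≤ t ^ 2 * B.rank := by gcongr
  have h0 : matInner (Z - B) D = 0 := by
    rw [hD, matInner_smul_right, matInner_vecMulVec, hv, h.residual_mulVec_eq_zero,
      dotProduct_zero, mul_zero]
  have h5 : Z - (B - D) = (Z - B) + D := by abel
  rw [h5, matInner_add_left, matInner_add_right, matInner_add_right, matInner_comm D, h0,
    hD, matInner_smul_vecMulVec_self _ hv0] at h1
  have h6 : t ^ 2 ≤ (v ⬝ᵥ v)⁻¹ * ((B *ᵥ v) ⬝ᵥ (B *ᵥ v)) := by linarith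
  rwa [le_inv_mul_iff₀ hvv, mul_comm] at h6

/-- The row space of `B` has dimension above `j`, so it meets the kernel of the `j` constraints on
which `‖Bx‖ ≤ σ_j(B) ‖x‖`. -/
theorem le_singularValue (h : IsRankPenalizedProjection Z t B) {j : ℕ}
    (hj : j < B.rank) : t ≤ singularValue B j := by
  obtain ⟨φ, hφ⟩ := (Matrix.toEuclideanLin B).exists_forall_ker_le_singularValues j
  have hr : Module.finrank ℝ (LinearMap.range (Matrix.toEuclideanLin Bᵀ)) = B.rank := by
    rw [finrank_range_toEuclideanLin, Matrix.rank_transpose]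
  have hker : LinearMap.ker (φ.domRestrict (LinearMap.range (Matrix.toEuclideanLin Bᵀ))) ≠ ⊥ :=
    LinearMap.ker_ne_bot_of_finrank_lt (by rw [hr]; simpa using hj)
  obtain ⟨x, hx, hx0⟩ := Submodule.exists_mem_ne_zero_of_ne_bot hker
  have hpos : 0 < ‖(x : EuclideanSpace ℝ (Fin m₂))‖ := by simpa using hx0
  exact le_of_mul_le_mul_right ((h.le_norm_apply x.2).trans (hφ x hx)) hpos

theorem norm_sq_apply_eq (h : IsRankPenalizedProjection Z t B) (x : EuclideanSpace ℝ (Fin m₂)) :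
    ‖Matrix.toEuclideanLin Z x‖ ^ 2
      = ‖Matrix.toEuclideanLin B x‖ ^ 2 + ‖Matrix.toEuclideanLin (Z - B) x‖ ^ 2 := by
  have hZ : Matrix.toEuclideanLin Z x
      = Matrix.toEuclideanLin B x + Matrix.toEuclideanLin (Z - B) x := by
    rw [← LinearMap.add_apply, ← map_add, add_sub_cancel]
  have h0 : inner ℝ (Matrix.toEuclideanLin B x) (Matrix.toEuclideanLin (Z - B) x) = 0 := by
    have : Matrix.toEuclideanLin Bᵀ (Matrix.toEuclideanLin (Z - B) x) = 0 := by
      rw [← toEuclideanLin_mul_apply, h.transpose_mul_residual, map_zero, LinearMap.zero_apply]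
    rw [inner_toEuclideanLin_left, this, inner_zero_right]
  rw [hZ, norm_add_sq_real, h0]
  ring

/-- Pythagoras gives `‖Bx‖ ≤ ‖Zx‖`, hence one inequality. For the other, `B` acts on its row space
and the residual on the orthogonal complement, with norm at most `t ≤ σ_j(B)`. -/
theorem singularValue_eq (h : IsRankPenalizedProjection Z t B) (ht : 0 ≤ t) {j : ℕ}
    (hj : j < B.rank) : singularValue B j = singularValue Z j := by
  have hB0 := singularValue_nonneg B j
  have hZ0 := singularValue_nonneg Z j
  refine le_antisymm ?_ ?_
  · obtain ⟨φ, hφ⟩ := (Matrix.toEuclideanLin Z).exists_forall_ker_le_singularValues j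
    refine LinearMap.singularValues_le_of_forall_ker _ hZ0 φ (by simp) fun x hx => ?_
    refine le_trans ?_ (hφ x hx)
    refine le_of_sq_le_sq ?_ (norm_nonneg _)
    rw [h.norm_sq_apply_eq x]
    exact le_add_of_nonneg_right (sq_nonneg _)
  · obtain ⟨φ, hφ⟩ := (Matrix.toEuclideanLin B).exists_forall_ker_le_singularValues j
    set K := LinearMap.range (Matrix.toEuclideanLin Bᵀ) with hK
    -- The `j` constraints bear only on the row space component of `x`; the complement needs none.
    refine LinearMap.singularValues_le_of_forall_ker _ hB0 (φ ∘ₗ K.starProjection.toLinearMap)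
      (by simp) fun x hx => ?_
    set p := K.starProjection x with hp
    have hpK : p ∈ K := K.starProjection_apply_mem x
    have hq : x - p ∈ Kᗮ := K.sub_starProjection_mem_orthogonal x
    have hBq : Matrix.toEuclideanLin B (x - p) = 0 := by
      rw [← inner_self_eq_zero (𝕜 := ℝ), inner_toEuclideanLin_left, real_inner_comm]
      exact hq _ ⟨_, rfl⟩
    have hBx : Matrix.toEuclideanLin B x = Matrix.toEuclideanLin B p := by
      rw [← sub_eq_zero, ← map_sub, hBq]
    have hWp : Matrix.toEuclideanLin (Z - B) p = 0 := by
      obtain ⟨w, hw⟩ := hpK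
      rw [← hw, ← toEuclideanLin_mul_apply, h.residual_mul_transpose, map_zero,
        LinearMap.zero_apply]
    have hWx : Matrix.toEuclideanLin (Z - B) x = Matrix.toEuclideanLin (Z - B) (x - p) := by
      rw [map_sub _ x p, hWp, sub_zero]
    have hpyth : ‖x‖ ^ 2 = ‖p‖ ^ 2 + ‖x - p‖ ^ 2 := by
      have hin : inner ℝ p (x - p) = 0 := hq p hpK
      have := norm_add_sq_real p (x - p)
      rw [hin, add_sub_cancel] at this
      linarith
    have h1 := hφ p hx
    have h2 := (h.norm_residual_apply_le ht (x - p)).trans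
      (mul_le_mul_of_nonneg_right (h.le_singularValue hj) (norm_nonneg _))
    refine le_of_sq_le_sq ?_ (by positivity)
    rw [mul_pow, hpyth, mul_add, ← mul_pow, ← mul_pow, h.norm_sq_apply_eq, hBx, hWx]
    gcongr
    exact h1

variable {A₀ : Matrix (Fin m₁) (Fin m₂) ℝ}

/-- Otherwise, at the index `A₀.rank`, `σ(Z) = σ(B) ≥ t`, although `σ(A₀) = 0` there and Weyl allows
a gap of `t/2` only. -/
theorem rank_le (h : IsRankPenalizedProjection Z t B) (ht : 0 < t)
    (hA : singularValue (Z - A₀) 0 ≤ t / 2) : B.rank ≤ A₀.rank := by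
  by_contra! hlt
  have h1 := h.le_singularValue hlt
  rw [h.singularValue_eq ht.le hlt] at h1
  have h2 := (le_abs_self _).trans ((abs_singularValue_sub_le Z A₀ A₀.rank).trans hA)
  rw [(singularValue_eq_zero_iff A₀ A₀.rank).2 le_rfl] at h2
  linarith

theorem abs_singularValue_sub_le (h : IsRankPenalizedProjection Z t B) (ht : 0 < t)
    (hA : singularValue (Z - A₀) 0 ≤ t / 2) {j : ℕ} (hj : j < B.rank) :
    |singularValue B j - singularValue A₀ j| ≤ t / 2 := by
  rw [h.singularValue_eq ht.le hj]
  exact (TraceRegression.abs_singularValue_sub_le Z A₀ j).trans hA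

theorem singularValue_sub_zero_le (h : IsRankPenalizedProjection Z t B) (ht : 0 < t)
    (hA : singularValue (Z - A₀) 0 ≤ t / 2) : singularValue (B - A₀) 0 ≤ 3 / 2 * t := by
  have h1 := TraceRegression.singularValue_sub_zero_le (Z - A₀) (Z - B)
  have h2 : singularValue (Z - B) 0 ≤ t :=
    LinearMap.singularValues_zero_le _ ht.le (h.norm_residual_apply_le ht.le)
  rw [sub_sub_sub_cancel_left] at h1
  linarith

/-- Comparing `B` with `A₀` leaves a cross term `2⟨B - A₀, Z - A₀⟩`; half of it is absorbed into the
squared error and half into the penalties. -/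
theorem matInner_sub_self_le (h : IsRankPenalizedProjection Z t B) (ht : 0 < t)
    (hA : singularValue (Z - A₀) 0 ≤ t / 2) :
    matInner (B - A₀) (B - A₀) ≤ 3 * t ^ 2 * A₀.rank := by
  have h1 := h A₀
  have h2 : Z - B = (Z - A₀) - (B - A₀) := by abel
  rw [h2, matInner_sub_self, matInner_comm (Z - A₀) (B - A₀)] at h1
  have hrank : (B - A₀).rank ≤ B.rank + A₀.rank := by
    rw [sub_eq_add_neg]
    exact (rank_add_le_rank_add_rank _ _).trans (Nat.add_le_add_left (rank_neg_le A₀) _)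
  have h3 := matInner_le_singularValue_mul_sqrt (B - A₀) (Z - A₀) hrank
  set f := matInner (B - A₀) (B - A₀)
  have hf : 0 ≤ f := matInner_self_nonneg _
  set R : ℝ := ((B.rank + A₀.rank : ℕ) : ℝ) with hR
  have hR0 : 0 ≤ R := Nat.cast_nonneg _
  have h4 : singularValue (Z - A₀) 0 * Real.sqrt (R * f) ≤ t / 2 * Real.sqrt (R * f) :=
    mul_le_mul_of_nonneg_right hA (Real.sqrt_nonneg _)
  -- Arithmetic-geometric mean inequality. The `rank B` part of `t²R/2` is covered by the penalty of
  -- `B`, leaving `f/2 ≤ (3/2) t² rank A₀`.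
  have h5 : t * Real.sqrt (R * f) ≤ (t ^ 2 * R + f) / 2 := by
    rw [Real.sqrt_mul hR0]
    nlinarith [sq_nonneg (t * Real.sqrt R - Real.sqrt f), Real.sq_sqrt hR0, Real.sq_sqrt hf]
  have h6 : 0 ≤ t ^ 2 * (B.rank : ℝ) := by positivity
  rw [hR, Nat.cast_add] at h5
  rw [hR, Nat.cast_add] at h4 h3
  linarith

end IsRankPenalizedProjection

end RankPenalty

end TraceRegression

/-! ### Interpolation of Schatten norms and conclusion. -/

namespace TraceRegression

/-- Interpolation of the Schatten-`q` norm, `2 ≤ q < ∞`, between the operator and the Frobenius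
norm. -/
theorem sum_rpow_singularValue_le {m₁ m₂ : ℕ} (D : Matrix (Fin m₁) (Fin m₂) ℝ) {q : ℝ}
    (hq : 2 ≤ q) {s : ℝ} (hs : singularValue D 0 ≤ s) :
    ∑ j ∈ Finset.range (min m₁ m₂), singularValue D j ^ q ≤ s ^ (q - 2) * matInner D D := by
  rw [← sum_sq_singularValue D (rank_le_min D), Finset.mul_sum]
  refine Finset.sum_le_sum fun j _ => ?_
  have h0 := singularValue_nonneg D j
  have h1 : singularValue D j ≤ s := (singularValue_antitone D (Nat.zero_le j)).trans hs
  rcases h0.eq_or_lt with h | h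
  · rw [← h, Real.zero_rpow (by linarith)]
    simp
  · calc singularValue D j ^ q = singularValue D j ^ (q - 2) * singularValue D j ^ 2 := by
          rw [← Real.rpow_natCast, ← Real.rpow_add h]; norm_num
      _ ≤ s ^ (q - 2) * singularValue D j ^ 2 := by
          gcongr

theorem eq_zero_of_rank_eq_zero {m₁ m₂ : ℕ} {A : Matrix (Fin m₁) (Fin m₂) ℝ} (h : A.rank = 0) :
    A = 0 := by
  rw [← matInner_self_eq_zero, ← sum_sq_singularValue A h.le, Finset.sum_range_zero]

theorem schattenNorm_zero {m₁ m₂ : ℕ} {q : ℝ≥0∞} (hq : q ≠ 0) :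
    schattenNorm q (0 : Matrix (Fin m₁) (Fin m₂) ℝ) = 0 := by
  have h : ∀ j, singularValue (0 : Matrix (Fin m₁) (Fin m₂) ℝ) j = 0 := fun j =>
    (singularValue_eq_zero_iff _ _).2 (by simp)
  rw [schattenNorm]
  split_ifs with hq'
  · exact h 0
  · have hpos : q.toReal ≠ 0 := (ENNReal.toReal_pos hq hq').ne'
    simp [h, Real.zero_rpow hpos, hpos]

/-- The factor `(4/3)^(2/q)` comes from `4 = (3/2)² (4/3)²`, which expresses the Frobenius bound
through the operator bound. -/
theorem schattenNorm_le_of_bounds {m₁ m₂ r : ℕ} {D : Matrix (Fin m₁) (Fin m₂) ℝ} {t : ℝ}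
    (ht : 0 < t) (hr : 0 < r) (hop : singularValue D 0 ≤ 3 / 2 * t)
    (hfro : matInner D D ≤ 4 * t ^ 2 * r) {q : ℝ≥0∞} (hq : 2 ≤ q) :
    schattenNorm q D ≤ 3 / 2 * (4 / 3 : ℝ) ^ (2 / q).toReal * t * qRoot q r := by
  have hr' : (r : ℝ) ≠ 0 := by positivity
  rw [qRoot, if_neg hr', schattenNorm]
  split_ifs with hq'
  · subst hq'
    simpa using hop
  have h2 : 2 ≤ q.toReal := by simpa using ENNReal.toReal_mono hq' hq
  set p := q.toReal with hp
  have hp0 : 0 < p := by linarith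
  have hsum := sum_rpow_singularValue_le D h2 hop
  have hbound : ∑ j ∈ Finset.range (min m₁ m₂), singularValue D j ^ p
      ≤ (3 / 2 * t) ^ p * ((4 / 3 : ℝ) ^ (2 : ℝ) * r) := by
    calc _ ≤ (3 / 2 * t) ^ (p - 2) * matInner D D := hsum
      _ ≤ (3 / 2 * t) ^ (p - 2) * (4 * t ^ 2 * r) := by gcongr
      _ = (3 / 2 * t) ^ (p - 2) * (3 / 2 * t) ^ (2 : ℝ) * ((4 / 3 : ℝ) ^ (2 : ℝ) * r) := by
          norm_num [Real.rpow_ofNat]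
          ring
      _ = _ := by rw [← Real.rpow_add (by positivity), sub_add_cancel]
  have hnn : 0 ≤ ∑ j ∈ Finset.range (min m₁ m₂), singularValue D j ^ p :=
    Finset.sum_nonneg fun j _ => Real.rpow_nonneg (singularValue_nonneg D j) _
  calc _ ≤ ((3 / 2 * t) ^ p * ((4 / 3 : ℝ) ^ (2 : ℝ) * r)) ^ (1 / p) :=
        Real.rpow_le_rpow hnn hbound (by positivity)
    _ = 3 / 2 * (4 / 3 : ℝ) ^ (2 / q).toReal * t * (r : ℝ) ^ (1 / q).toReal := by
        rw [Real.mul_rpow (x := (3 / 2 * t) ^ p) (by positivity) (by positivity),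
          Real.mul_rpow (x := (4 / 3 : ℝ) ^ (2 : ℝ)) (by positivity) (by positivity), ← Real.rpow_mul (by positivity), ← Real.rpow_mul (by positivity),
          mul_one_div_cancel hp0.ne', ENNReal.toReal_div, ENNReal.toReal_div, ← hp]
        simp only [Real.rpow_one, ENNReal.toReal_ofNat, ENNReal.toReal_one, mul_one_div]
        ring

end TraceRegression

theorem theorem3 {Ω : Type*} [MeasurableSpace Ω] (P : Measure Ω) [IsProbabilityMeasure P]
    (n m₁ m₂ : ℕ) (hn : 0 < n) (hm₁ : 0 < m₁) (hm₂ : 0 < m₂)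
    (X : Fin n → Ω → Matrix (Fin m₁) (Fin m₂) ℝ) (Y : Fin n → Ω → ℝ)
    (A₀ : Matrix (Fin m₁) (Fin m₂) ℝ)
    (hmodel : TraceRegression.IsTraceRegression P X Y A₀)
    (hUSR : TraceRegression.IsUSR P X)
    (lam : ℝ) (hlam : 0 < lam) (ω : Ω) :
    -- the hard thresholding of the singular values of the data matrix is the estimator
    (∀ Ahat : Matrix (Fin m₁) (Fin m₂) ℝ,
      TraceRegression.IsHardThresholding (TraceRegression.dataMatrix X Y ω)
          (Real.sqrt (lam * m₁ * m₂)) Ahat →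
        TraceRegression.IsRankPenalizedEstimator P X Y lam ω Ahat) ∧
    -- the bounds, for every minimizer of the criterion
    (∀ μ : ℝ, TraceRegression.LowerIsometry P X μ →
      2 * μ * TraceRegression.noiseLevel P X Y ω ≤ Real.sqrt lam →
      ∀ Ahat : Matrix (Fin m₁) (Fin m₂) ℝ,
        TraceRegression.IsRankPenalizedEstimator P X Y lam ω Ahat →
        Ahat.rank ≤ A₀.rank ∧
        (∀ j : ℕ, j < Ahat.rank →
          |TraceRegression.singularValue Ahat j - TraceRegression.singularValue A₀ j|
            ≤ Real.sqrt (lam * m₁ * m₂) / 2) ∧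
        TraceRegression.schattenNorm ⊤ (Ahat - A₀) ≤ 3 / 2 * Real.sqrt (lam * m₁ * m₂) ∧
        (∀ q : ℝ≥0∞, 2 ≤ q →
          TraceRegression.schattenNorm q (Ahat - A₀)
            ≤ 3 / 2 * (4 / 3 : ℝ) ^ (2 / q).toReal * Real.sqrt (m₁ * m₂ * lam)
              * TraceRegression.qRoot q A₀.rank)) := by
  have hX := hmodel.measurable_X
  have hm : (0 : ℝ) < m₁ * m₂ := by positivity
  have ht : 0 < Real.sqrt (lam * m₁ * m₂) := Real.sqrt_pos.2 (by positivity)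
  have ht2 : Real.sqrt (lam * m₁ * m₂) ^ 2 = lam * m₁ * m₂ := Real.sq_sqrt (by positivity)
  have hiff : ∀ B, TraceRegression.IsRankPenalizedEstimator P X Y lam ω B ↔
      TraceRegression.IsRankPenalizedProjection (TraceRegression.dataMatrix X Y ω)
        (Real.sqrt (lam * m₁ * m₂)) B := by
    intro B
    rw [hUSR.isRankPenalizedEstimator_iff hX hn hm₁ hm₂,
      TraceRegression.IsRankPenalizedProjection, ht2]
  refine ⟨fun B hB => (hiff B).2 (hB.isRankPenalizedProjection ht.le), fun μ hμ hΔ B hB => ?_⟩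
  have h := (hiff B).1 hB
  have hA : TraceRegression.singularValue (TraceRegression.dataMatrix X Y ω - A₀) 0
      ≤ Real.sqrt (lam * m₁ * m₂) / 2 := by
    have h1 : Real.sqrt (m₁ * m₂) ≤ μ :=
      Real.sqrt_le_iff.2 ⟨hμ.1.le, hUSR.mul_le_sq_of_lowerIsometry hX hn hm₁ hm₂ hμ⟩
    have h2 : (m₁ * m₂ : ℝ)⁻¹ *
        TraceRegression.singularValue (TraceRegression.dataMatrix X Y ω - A₀) 0
          ≤ TraceRegression.noiseLevel P X Y ω := by
      rw [TraceRegression.noiseLevel, TraceRegression.schattenNorm, if_pos rfl,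
        hmodel.noiseMatrix_eq hUSR hn hm₁ hm₂]
      exact TraceRegression.singularValue_smul_zero (by positivity) _
    set σ := TraceRegression.singularValue (TraceRegression.dataMatrix X Y ω - A₀) 0
    have h0 : 0 ≤ σ := TraceRegression.singularValue_nonneg _ _
    have hΔ0 : 0 ≤ TraceRegression.noiseLevel P X Y ω := le_trans (by positivity) h2
    have hs : 0 < Real.sqrt (m₁ * m₂ : ℝ) := Real.sqrt_pos.2 hm
    have hss : Real.sqrt (m₁ * m₂ : ℝ) * Real.sqrt (m₁ * m₂ : ℝ) = m₁ * m₂ :=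
      Real.mul_self_sqrt hm.le
    rw [inv_mul_le_iff₀ hm] at h2
    rw [mul_assoc lam, Real.sqrt_mul hlam.le]
    have h3 : Real.sqrt (m₁ * m₂ : ℝ) * TraceRegression.noiseLevel P X Y ω
        ≤ Real.sqrt lam / 2 := by
      have := mul_le_mul_of_nonneg_right h1 hΔ0
      linarith
    -- One factor `√(m₁m₂)` of the scaling is absorbed by `μ`, the other turns `√lam` into `t`.
    calc σ ≤ Real.sqrt (m₁ * m₂ : ℝ) *
          (Real.sqrt (m₁ * m₂ : ℝ) * TraceRegression.noiseLevel P X Y ω) := by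
          rwa [← mul_assoc, hss]
      _ ≤ Real.sqrt (m₁ * m₂ : ℝ) * (Real.sqrt lam / 2) :=
          mul_le_mul_of_nonneg_left h3 hs.le
      _ = _ := by ring
  have hrank := h.rank_le ht hA
  have hop := h.singularValue_sub_zero_le ht hA
  refine ⟨hrank, fun j hj => h.abs_singularValue_sub_le ht hA hj, ?_, fun q hq => ?_⟩
  · rw [TraceRegression.schattenNorm, if_pos rfl]
    exact hop
  · have hcomm : (m₁ : ℝ) * m₂ * lam = lam * m₁ * m₂ := by ring
    rw [hcomm]
    -- At rank zero the right side is 0 even for `q = ∞`, so (iii) is not enough; but (i) forces `B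
    -- = A₀ = 0`.
    rcases Nat.eq_zero_or_pos A₀.rank with h0 | h0
    · have hB0 : B = 0 := TraceRegression.eq_zero_of_rank_eq_zero (by omega)
      have hA0 : A₀ = 0 := TraceRegression.eq_zero_of_rank_eq_zero h0
      rw [hB0, hA0, sub_zero, TraceRegression.schattenNorm_zero (by rintro rfl; simp at hq)]
      simp [TraceRegression.qRoot]
    · refine TraceRegression.schattenNorm_le_of_bounds ht h0 hop ?_ hq
      refine (h.matInner_sub_self_le ht hA).trans ?_
      gcongr
      norm_num
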